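/- Let $m\le n$ and $k$ be non-negative integers, and let $W$ be an $(n-m)$-dimensional linear subspace of $\mathbb{R}^n$. Let $G(k,n)$ be the Grassmannian of $k$-dimensional linear subspaces of $\mathbb{R}^n$, with its usual smooth structure (given by the graph charts) and with the canonical connection of the symmetric space $G(k,n)\simeq O(n)/(O(k)\times O(n-k))$. Here the origin is $o=\mathrm{span}(e_1,\dots,e_k)$, the involution is $A\mapsto SAS^{-1}$ with $S=\mathrm{diag}(-I_k,I_{n-k})$, and $\mathfrak{m}\subset\mathfrak{o}(n)$ is the $(-1)$-eigenspace of this involution, that is, the space of all block matrices $m(X)=\begin{pmatrix}0&-X^{\mathsf T}\\X&0\end{pmatrix}$ with $X\in\mathbb{R}^{(n-k)\times k}$. Let $N\subset G(k,n)$ be the set of all $k$-planes orthogonal to $W$. Then: 1. $N$ is an embedded smooth submanifold of $G(k,n)$ and is diffeomorphic to $G(k,m)$; that is, $N$ is the image of a smooth embedding $f\colon G(k,m)\to G(k,n)$. 2. $N$ is totally geodesic: for every $P\in N$ and every $v\in T_PN$, the geodesic of $G(k,n)$ through $P$ with initial velocity $v$ is contained in $N$ for sufficiently small times. 3. The subspace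 of $\mathfrak{m}$ corresponding to $N$ is a Lie triple system: if $g\in O(n)$ is such that $g\cdot o\in N$, then $\mathfrak{m}'=\{A\in\mathfrak{m}: A\,g^{-1}w=0\text{ for all }w\in W\}$ satisfies $[[\mathfrak{m}',\mathfrak{m}'],\mathfrak{m}']\subset\mathfrak{m}'$, and an element $A\in\mathfrak{m}$ lies in $\mathfrak{m}'$ if and only if the geodesic with initial data $(g,A)$, that is, the curve $t\mapsto g\exp(tA)\cdot o$, is tangent to $N$ at $t=0$. -/

import Mathlib

open scoped Manifold ContDiff

attribute [local instance 100] LieRing.ofAssociativeRing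

noncomputable section

namespace Grass

/-- Euclidean space `ℝⁿ`. -/
abbrev E (n : ℕ) : Type := EuclideanSpace ℝ (Fin n)

/-- The Grassmannian `G(k,n)`: the set of `k`-dimensional linear subspaces of `ℝⁿ`. -/
def Gr (k n : ℕ) : Type := {P : Submodule ℝ (E n) // Module.finrank ℝ P = k}

/-- The model space `Hom(ℝᵏ, ℝⁿ⁻ᵏ) ≅ ℝ^((n-k) × k)` of `G(k,n)`. -/
abbrev Model (k n : ℕ) : Type := E k →L[ℝ] E (n - k)

/-! ### The smooth structure of `G(k,n)` through graph charts -/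

/-- A linear frame: an identification of `ℝᵏ × ℝⁿ⁻ᵏ` with `ℝⁿ`. -/
abbrev Frame (k n : ℕ) : Type := (E k × E (n - k)) ≃L[ℝ] E n

/-- The image under the frame `A` of the graph of `X : ℝᵏ → ℝⁿ⁻ᵏ`. -/
def graphSub {k n : ℕ} (A : Frame k n) (X : Model k n) : Submodule ℝ (E n) :=
  (LinearMap.graph (X : E k →ₗ[ℝ] E (n - k))).map (A.toLinearEquiv : (E k × E (n - k)) →ₗ[ℝ] E n)

theorem finrank_graphSub {k n : ℕ} (A : Frame k n) (X : Model k n) :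
    Module.finrank ℝ (graphSub A X) = k := by
  unfold graphSub
  rw [LinearEquiv.finrank_map_eq, LinearMap.graph_eq_range_prod, LinearMap.finrank_range_of_inj]
  · simp
  · intro x y h
    exact congrArg Prod.fst h

/-- The `k`-plane that is the image under `A` of the graph of `X`. -/
def graphPlane {k n : ℕ} (A : Frame k n) (X : Model k n) : Gr k n :=
  ⟨graphSub A X, finrank_graphSub A X⟩

theorem mem_graphSub {k n : ℕ} (A : Frame k n) (X : Model k n) (x : E n) :
    x ∈ graphSub A X ↔ (A.symm x).2 = X (A.symm x).1 := by
  unfold graphSub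
  rw [Submodule.mem_map]
  constructor
  · rintro ⟨y, hy, rfl⟩
    simpa [LinearMap.mem_graph_iff] using hy
  · intro h
    exact ⟨A.symm x, by simpa [LinearMap.mem_graph_iff] using h, by simp⟩

/-- `fst ∘ B⁻¹ ∘ A ∘ (id, X)`. -/
def pMap {k n : ℕ} (A B : Frame k n) (X : Model k n) : E k →L[ℝ] E k :=
  ((ContinuousLinearMap.fst ℝ (E k) (E (n - k))).comp
    ((B.symm : E n →L[ℝ] (E k × E (n - k))).comp (A : (E k × E (n - k)) →L[ℝ] E n))).comp
    ((ContinuousLinearMap.inl ℝ (E k) (E (n - k))) +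
      (ContinuousLinearMap.inr ℝ (E k) (E (n - k))).comp X)

/-- `snd ∘ B⁻¹ ∘ A ∘ (id, X)`. -/
def qMap {k n : ℕ} (A B : Frame k n) (X : Model k n) : E k →L[ℝ] E (n - k) :=
  ((ContinuousLinearMap.snd ℝ (E k) (E (n - k))).comp
    ((B.symm : E n →L[ℝ] (E k × E (n - k))).comp (A : (E k × E (n - k)) →L[ℝ] E n))).comp
    ((ContinuousLinearMap.inl ℝ (E k) (E (n - k))) +
      (ContinuousLinearMap.inr ℝ (E k) (E (n - k))).comp X)

theorem pMap_apply {k n : ℕ} (A B : Frame k n) (X : Model k n) (v : E k) :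
    pMap A B X v = (B.symm (A (v, X v))).1 := by
  simp [pMap, ← Prod.fst_add, ← map_add]

theorem qMap_apply {k n : ℕ} (A B : Frame k n) (X : Model k n) (v : E k) :
    qMap A B X v = (B.symm (A (v, X v))).2 := by
  simp [qMap, ← Prod.snd_add, ← map_add]

theorem contDiff_pMap {k n : ℕ} (A B : Frame k n) : ContDiff ℝ ∞ (pMap A B) := by
  unfold pMap
  fun_prop

theorem contDiff_qMap {k n : ℕ} (A B : Frame k n) : ContDiff ℝ ∞ (qMap A B) := by
  unfold qMap
  fun_prop

theorem graphPlane_eq_iff {k n : ℕ} (A B : Frame k n) (X Y : Model k n) :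
    graphPlane A X = graphPlane B Y ↔
      IsUnit (pMap A B X) ∧ Y = (qMap A B X).comp (Ring.inverse (pMap A B X)) := by
  have key : graphPlane A X = graphPlane B Y ↔
      ∀ x, x ∈ graphSub A X ↔ x ∈ graphSub B Y := by
    rw [← SetLike.ext_iff]
    exact Subtype.ext_iff
  rw [key]
  constructor
  · intro h
    have hq : ∀ v, qMap A B X v = Y (pMap A B X v) := by
      intro v
      have := (h (A (v, X v))).1 ((mem_graphSub A X _).2 (by simp))
      rw [mem_graphSub] at this
      rw [qMap_apply, pMap_apply, this]
    have hs : Function.Surjective (pMap A B X) := by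
      intro w
      have := (h (B (w, Y w))).2 ((mem_graphSub B Y _).2 (by simp))
      rw [mem_graphSub] at this
      refine ⟨(A.symm (B (w, Y w))).1, ?_⟩
      rw [pMap_apply, ← this]
      simp
    have hu : IsUnit (pMap A B X) := by
      rw [ContinuousLinearMap.isUnit_iff_bijective]
      exact ⟨(LinearMap.injective_iff_surjective (f := (pMap A B X : E k →ₗ[ℝ] E k))).2 hs, hs⟩
    refine ⟨hu, ?_⟩
    have : qMap A B X = Y.comp (pMap A B X) := by
      ext1 v
      exact hq v
    rw [this, ContinuousLinearMap.comp_assoc]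
    have h1 := Ring.mul_inverse_cancel _ hu
    change (pMap A B X).comp (Ring.inverse (pMap A B X)) = _ at h1
    rw [h1]
    rfl
  · rintro ⟨hu, hY⟩
    have h1 := Ring.mul_inverse_cancel _ hu
    have h2 := Ring.inverse_mul_cancel _ hu
    have hq : ∀ v, qMap A B X v = Y (pMap A B X v) := by
      intro v
      have := congrArg (fun f : E k →L[ℝ] E k => f v) h2
      simp only [mul_apply_eq_comp, one_apply_eq_self] at this
      rw [hY, ContinuousLinearMap.comp_apply, this]
    intro x
    rw [mem_graphSub, mem_graphSub]
    constructor
    · intro hx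
      have hx' : x = A ((A.symm x).1, X (A.symm x).1) := by
        rw [← hx]; simp
      have := hq (A.symm x).1
      rw [qMap_apply, pMap_apply, ← hx'] at this
      exact this
    · intro hx
      set w := (B.symm x).1 with hw
      have hx' : x = B (w, Y w) := by
        rw [← hx]; simp [hw]
      set v := Ring.inverse (pMap A B X) w with hv
      have hpv : pMap A B X v = w := by
        have := congrArg (fun f : E k →L[ℝ] E k => f w) h1
        simpa only [mul_apply_eq_comp, one_apply_eq_self] using this
      have hx2 : x = A (v, X v) := by
        rw [hx', ← hpv, ← hq, pMap_apply, qMap_apply]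
        simp
      rw [hx2]
      simp

theorem graphPlane_injective {k n : ℕ} (A : Frame k n) :
    Function.Injective (graphPlane (k := k) (n := n) A) := by
  intro X Y h
  have h' := congrArg Subtype.val h
  ext1 v
  have := (mem_graphSub A Y (A (v, X v))).1 (by
    change _ ∈ (graphPlane A Y).1
    rw [← h']
    exact (mem_graphSub A X _).2 (by simp))
  simpa using this

/-- The graph chart of the frame `A`: its domain is the set of the images of graphs under `A`,
and it sends the image of the graph of `X` to `X`. -/
def grChart {k n : ℕ} (A : Frame k n) : PartialEquiv (Gr k n) (Model k n) where
  toFun := Function.invFun (graphPlane A)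
  invFun := graphPlane A
  source := Set.range (graphPlane A)
  target := Set.univ
  map_source' := fun _ _ => Set.mem_univ _
  map_target' := fun X _ => ⟨X, rfl⟩
  left_inv' := by
    rintro _ ⟨X, rfl⟩
    rw [Function.leftInverse_invFun (graphPlane_injective A) X]
  right_inv' := fun X _ => Function.leftInverse_invFun (graphPlane_injective A) X

theorem grChart_trans_source {k n : ℕ} (A B : Frame k n) :
    ((grChart A).symm.trans (grChart B)).source = {X | IsUnit (pMap A B X)} := by
  ext X
  simp only [PartialEquiv.trans_source, PartialEquiv.symm_source, Set.mem_inter_iff,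
    Set.mem_preimage, Set.mem_ofPred_eq]
  constructor
  · rintro ⟨-, Y, hY⟩
    exact ((graphPlane_eq_iff A B X Y).1 hY.symm).1
  · intro h
    exact ⟨Set.mem_univ _, _, ((graphPlane_eq_iff A B X _).2 ⟨h, rfl⟩).symm⟩

theorem grChart_trans_apply {k n : ℕ} (A B : Frame k n) (X : Model k n)
    (h : IsUnit (pMap A B X)) :
    (grChart A).symm.trans (grChart B) X = (qMap A B X).comp (Ring.inverse (pMap A B X)) := by
  have := (graphPlane_eq_iff A B X _).2 ⟨h, rfl⟩
  change Function.invFun (graphPlane B) (graphPlane A X) = _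
  rw [this, Function.leftInverse_invFun (graphPlane_injective B)]

theorem contDiffOn_grChart_trans {k n : ℕ} (A B : Frame k n) :
    ContDiffOn ℝ ∞ ((grChart A).symm.trans (grChart B))
      ((grChart A).symm.trans (grChart B)).source := by
  rw [grChart_trans_source]
  have : ContDiffOn ℝ ∞ (fun X => (qMap A B X).comp (Ring.inverse (pMap A B X)))
      {X | IsUnit (pMap A B X)} := by
    intro X hX
    refine ContDiffAt.contDiffWithinAt ?_
    refine ContDiffAt.clm_comp (contDiff_qMap A B).contDiffAt ?_
    obtain ⟨u, hu⟩ := hX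
    have h1 : ContDiffAt ℝ ∞ Ring.inverse (pMap A B X) := by
      rw [← hu]
      exact contDiffAt_ringInverse ℝ u
    exact h1.comp X (contDiff_pMap A B).contDiffAt
  exact this.congr fun X hX => grChart_trans_apply A B X hX

theorem exists_frame {k n : ℕ} (P : Gr k n) : ∃ A : Frame k n, P ∈ (grChart A).source := by
  obtain ⟨P, hP⟩ := P
  have h2 : Module.finrank ℝ Pᗮ = n - k := by
    have := P.finrank_add_finrank_orthogonal
    simp only [finrank_euclideanSpace, Fintype.card_fin] at this
    omega
  let e1 : E k ≃ₗ[ℝ] P := LinearEquiv.ofFinrankEq _ _ (by simp [hP])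
  let e2 : E (n - k) ≃ₗ[ℝ] Pᗮ := LinearEquiv.ofFinrankEq _ _ (by simp [h2])
  let A : Frame k n := ((e1.prodCongr e2).trans
    (Submodule.prodEquivOfIsCompl P Pᗮ P.isCompl_orthogonal)).toContinuousLinearEquiv
  refine ⟨A, 0, ?_⟩
  apply Subtype.ext
  change graphSub A 0 = P
  have hA : ∀ v w, A (v, w) = (e1 v : E n) + (e2 w : E n) := by
    intro v w
    simp [A]
  ext x
  rw [mem_graphSub]
  constructor
  · intro hx
    have hx' : x = A ((A.symm x).1, 0) := by
      rw [show (0 : E (n - k)) = (A.symm x).2 from by simpa using hx.symm]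
      simp
    rw [hx', hA]
    simp
  · intro hx
    have hx' : x = A (e1.symm ⟨x, hx⟩, 0) := by
      rw [hA]; simp
    rw [hx']
    simp

/-- The atlas of `G(k,n)` formed by all graph charts. -/
def grCore (k n : ℕ) : ChartedSpaceCore (Model k n) (Gr k n) where
  atlas := Set.range grChart
  chartAt := fun P => grChart (exists_frame P).choose
  mem_chart_source := fun P => (exists_frame P).choose_spec
  chart_mem_atlas := fun _ => ⟨_, rfl⟩
  open_source := by
    rintro _ _ ⟨A, rfl⟩ ⟨B, rfl⟩
    rw [grChart_trans_source]
    exact Units.isOpen.preimage (contDiff_pMap A B).continuous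
  continuousOn_toFun := by
    rintro _ _ ⟨A, rfl⟩ ⟨B, rfl⟩
    exact (contDiffOn_grChart_trans A B).continuousOn

instance (k n : ℕ) : TopologicalSpace (Gr k n) := (grCore k n).toTopologicalSpace

instance (k n : ℕ) : ChartedSpace (Model k n) (Gr k n) := (grCore k n).toChartedSpace

instance (k n : ℕ) : IsManifold 𝓘(ℝ, Model k n) ∞ (Gr k n) := by
  refine isManifold_of_contDiffOn _ _ _ ?_
  intro e e' he he'
  have hmem : ∀ c ∈ atlas (Model k n) (Gr k n), ∃ A : Frame k n, c.toPartialEquiv = grChart A := by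
    intro c hc
    change c ∈ (grCore k n).toChartedSpace.atlas at hc
    change c ∈ ⋃ (e : PartialEquiv (Gr k n) (Model k n)) (he : e ∈ (grCore k n).atlas),
      {(grCore k n).openPartialHomeomorph e he} at hc
    simp only [Set.mem_iUnion, Set.mem_singleton_iff] at hc
    obtain ⟨_, ⟨A, rfl⟩, rfl⟩ := hc
    exact ⟨A, rfl⟩
  obtain ⟨A, hA⟩ := hmem e he
  obtain ⟨B, hB⟩ := hmem e' he'
  have h := contDiffOn_grChart_trans A B
  rw [← hA, ← hB] at h
  simpa using! h

/-! ### The symmetric space structure `G(k,n) ≅ O(n)/(O(k) × O(n-k))` -/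

/-- `S = diag(-I_k, I_{n-k})`; the involution of `O(n)`, and of `𝔬(n)`, is `A ↦ S A S⁻¹ = S A S`. -/
def S (k n : ℕ) : Matrix (Fin n) (Fin n) ℝ :=
  Matrix.diagonal fun i => if (i : ℕ) < k then -1 else 1

/-- The `(-1)`-eigenspace `𝔪` of the involution `A ↦ S A S` of `𝔬(n)`. -/
def mSpace (k n : ℕ) : Submodule ℝ (Matrix (Fin n) (Fin n) ℝ) where
  carrier := {A | A ∈ LieAlgebra.Orthogonal.so (Fin n) ℝ ∧ S k n * A * S k n = -A}
  zero_mem' := by simp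
  add_mem' := by
    rintro A B ⟨hA, hA'⟩ ⟨hB, hB'⟩
    exact ⟨add_mem hA hB, by rw [mul_add, add_mul, hA', hB', neg_add]⟩
  smul_mem' := by
    rintro c A ⟨hA, hA'⟩
    exact ⟨(LieAlgebra.Orthogonal.so (Fin n) ℝ).smul_mem c hA,
      by rw [mul_smul_comm, smul_mul_assoc, hA', smul_neg]⟩

/-- A Lie triple system: a linear subspace `V` of a Lie algebra with `[[V,V],V] ⊆ V`. -/
def IsLieTripleSystem {L : Type*} [LieRing L] [LieAlgebra ℝ L] (V : Submodule ℝ L) : Prop :=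
  ∀ a ∈ V, ∀ b ∈ V, ∀ c ∈ V, ⁅⁅a, b⁆, c⁆ ∈ V

/-- The origin `o`, the span of the first `k` standard basis vectors of `ℝⁿ`. -/
def origin (k n : ℕ) : Submodule ℝ (E n) :=
  Submodule.span ℝ {x | ∃ i : Fin n, (i : ℕ) < k ∧ x = EuclideanSpace.single i 1}

/-- The subspace `g·o` for `g ∈ O(n)`. -/
def orbit (k : ℕ) {n : ℕ} (g : Matrix.orthogonalGroup (Fin n) ℝ) : Submodule ℝ (E n) :=
  (origin k n).map (Matrix.toEuclideanLin (g : Matrix (Fin n) (Fin n) ℝ))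

/-- `h` is a horizontal lift of the curve `γ` in `G(k,n)` to `O(n)`, for the canonical connection
(the horizontal space at `g ∈ O(n)` is `g𝔪`): `γ(t) = h(t)·o` and `h'(t) = h(t) X(t)` with
`X(t) ∈ 𝔪`. Under `TM = O(n) ×_H 𝔪`, the velocity of `γ` at time `t` is the class of
`(h(t), X(t))`. -/
structure IsHorizontalLift {k n : ℕ} (γ : ℝ → Gr k n)
    (h : ℝ → Matrix.orthogonalGroup (Fin n) ℝ) (X : ℝ → Matrix (Fin n) (Fin n) ℝ) : Prop where
  lifts : ∀ t, (γ t).1 = orbit k (h t)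
  mem : ∀ t, X t ∈ mSpace k n
  deriv : ∀ t, HasDerivAt (fun s => (h s : Matrix (Fin n) (Fin n) ℝ))
    ((h t : Matrix (Fin n) (Fin n) ℝ) * X t) t

/-- `γ` is the geodesic of the canonical connection with initial data `(g, A)`, that is, starting
at `g·o` with the initial velocity given by the class of `(g, A)`. The covariant derivative of the
velocity, the class of `(h, X)`, along `γ` is by definition the class of `(h, X')`, so a curve is a
geodesic if and only if `X' = 0`. -/
def IsGeodesicFrom {k n : ℕ} (g : Matrix.orthogonalGroup (Fin n) ℝ)
    (A : Matrix (Fin n) (Fin n) ℝ) (γ : ℝ → Gr k n) : Prop :=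
  ∃ h X, IsHorizontalLift γ h X ∧ (∀ t, HasDerivAt X 0 t) ∧ h 0 = g ∧ X 0 = A

/-- `γ : ℝ → G(k,n)` is a geodesic of the canonical connection. -/
def IsGeodesic {k n : ℕ} (γ : ℝ → Gr k n) : Prop :=
  ∃ g A, IsGeodesicFrom g A γ

/-- The tangent bundle of `G(k,n)`. -/
abbrev TGr (k n : ℕ) : Type := TangentBundle 𝓘(ℝ, Model k n) (Gr k n)

/-- The velocity `γ'(t) ∈ T_{γ(t)} G(k,n)`, as a point `(γ(t), γ'(t))` of the tangent bundle. -/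
def velocity {k n : ℕ} (γ : ℝ → Gr k n) (t : ℝ) : TGr k n :=
  ⟨γ t, mfderiv 𝓘(ℝ, ℝ) 𝓘(ℝ, Model k n) γ t (1 : ℝ)⟩

/-- The tangent bundle of the embedded submanifold `f(M)` of `G(k,n)`, as a subset of the tangent
bundle of `G(k,n)`: the set of all `(f y, df_y u)`. -/
def tangentBundleOf {k n : ℕ} (F : Type*) {M : Type*} [NormedAddCommGroup F]
    [NormedSpace ℝ F] [TopologicalSpace M] [ChartedSpace F M] (f : M → Gr k n) : Set (TGr k n) :=
  Set.range (tangentMap 𝓘(ℝ, F) 𝓘(ℝ, Model k n) f)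

/-- `f` is a smooth embedding and the submanifold `f(M)` of `G(k,n)` is totally geodesic: for each
`x ∈ f(M)` and `v ∈ T_x f(M)` the geodesic through `x` with the velocity `v` exists and is contained
in `f(M)` for small times. -/
structure IsTotallyGeodesicEmbedding {k n : ℕ} (F : Type*) {M : Type*} [NormedAddCommGroup F]
    [NormedSpace ℝ F] [TopologicalSpace M] [ChartedSpace F M] (f : M → Gr k n) : Prop where
  embedding : Manifold.IsSmoothEmbedding 𝓘(ℝ, F) 𝓘(ℝ, Model k n) ∞ f
  exists_geodesic : ∀ v ∈ tangentBundleOf F f, ∃ γ : ℝ → Gr k n, IsGeodesic γ ∧ velocity γ 0 = v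
  geodesic_mem : ∀ γ : ℝ → Gr k n, IsGeodesic γ → velocity γ 0 ∈ tangentBundleOf F f →
    ∃ ε > 0, ∀ t, |t| < ε → γ t ∈ Set.range f

/-- The set of the `k`-planes that are orthogonal to `W`. -/
def planesOrthogonalTo (k : ℕ) {n : ℕ} (W : Submodule ℝ (E n)) : Set (Gr k n) :=
  {P | P.1 ⟂ W}

/-- `𝔪' = {A ∈ 𝔪 : A (g⁻¹ w) = 0 for all w ∈ W}`. If `W` is orthogonal to `g·o`, then `g⁻¹ W` is
the column space of a block matrix `(0; R)` with `k` zero rows, and `𝔪' = {m(X) : Xᵀ R = 0}`, where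
`m(X)` is the skew-symmetric matrix with the blocks `0, -Xᵀ; X, 0`. -/
def mSpaceOf (k : ℕ) {n : ℕ} (W : Submodule ℝ (E n)) (g : Matrix.orthogonalGroup (Fin n) ℝ) :
    Submodule ℝ (Matrix (Fin n) (Fin n) ℝ) where
  carrier := {A | A ∈ mSpace k n ∧ ∀ w ∈ W, A.mulVec
    (((g⁻¹ : Matrix.orthogonalGroup (Fin n) ℝ) : Matrix (Fin n) (Fin n) ℝ).mulVec w) = 0}
  zero_mem' := ⟨zero_mem _, fun w _ => Matrix.zero_mulVec _⟩
  add_mem' := by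
    rintro A B ⟨hA, hA'⟩ ⟨hB, hB'⟩
    refine ⟨add_mem hA hB, fun w hw => ?_⟩
    rw [Matrix.add_mulVec, hA' w hw, hB' w hw, add_zero]
  smul_mem' := by
    rintro c A ⟨hA, hA'⟩
    refine ⟨Submodule.smul_mem _ c hA, fun w hw => ?_⟩
    rw [Matrix.smul_mulVec, hA' w hw, smul_zero]

end Grass

end

noncomputable section

namespace Grass

/-! ### Graph charts and tangent vectors -/

/-! A `k`-plane is orthogonal to `W` iff it lies in `Wᗮ ≅ ℝᵐ`, so pushing planes forward along `ℝᵐ ≅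
Wᗮ ⊂ ℝⁿ` gives a bijection `pushPlane` of `G(k,m)` onto `N`. In a frame of `ℝᵐ` and its extension by
`W`, this map is the linear inclusion `X ↦ (X, 0)` (`pushPlane_graphPlane`). Hence it is an
immersion, it has continuous local left inverses, and the tangent vectors of `N` are those whose
`Hom(ℝᵏ, W)` coordinate vanishes.

A geodesic with data `(g, A)` has a lift with `h' = hA` and `A ∈ 𝔪` constant. Let `w ∈ W` and `u =
g⁻¹w`, which is orthogonal to `o`. If `Au = 0`, then `(hu)' = hAu = 0`, so `h(t)u = w` and `h(t)·o ⟂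
w` for all `t`: data in `𝔪'` give geodesics that never leave `N`. Conversely, tangency to `N` means
`gAx ⟂ W` for all `x ∈ o`. Since `A` maps `oᗮ` into `o`, one may take `x = Au`, and skewness gives
`0 = ⟪gAAu, w⟫ = -‖Au‖²`. So tangency to `N` is equivalent to `A ∈ 𝔪'`
(`IsGeodesicFrom.velocity_mem_iff`), which yields total geodesy as well. The triple bracket is pure
algebra: matrices killing `g⁻¹W` are closed under brackets. -/

/-- `Gr k n` is empty for `k > n`. A point supplies the inequality that makes the truncated `n - k`
the true codimension. -/
theorem le_of_gr {k n : ℕ} (P : Gr k n) : k ≤ n := by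
  have := P.1.finrank_le
  rw [P.2] at this
  simpa using this

/-- The graph chart of the frame `A` as a homeomorphism onto the model space. -/
def frameChart {k n : ℕ} (A : Frame k n) : OpenPartialHomeomorph (Gr k n) (Model k n) :=
  (grCore k n).openPartialHomeomorph (grChart A) ⟨A, rfl⟩

theorem frameChart_mem_atlas {k n : ℕ} (A : Frame k n) :
    frameChart A ∈ atlas (Model k n) (Gr k n) := by
  change _ ∈ ⋃ (e : PartialEquiv (Gr k n) (Model k n)) (he : e ∈ (grCore k n).atlas),
      {(grCore k n).openPartialHomeomorph e he}
  simp only [Set.mem_iUnion, Set.mem_singleton_iff]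
  exact ⟨grChart A, ⟨A, rfl⟩, rfl⟩

theorem frameChart_mem_maximalAtlas {k n : ℕ} (A : Frame k n) :
    frameChart A ∈ IsManifold.maximalAtlas 𝓘(ℝ, Model k n) ∞ (Gr k n) :=
  IsManifold.subset_maximalAtlas (frameChart_mem_atlas A)

@[simp]
theorem frameChart_symm_apply {k n : ℕ} (A : Frame k n) (X : Model k n) :
    (frameChart A).symm X = graphPlane A X := rfl

@[simp]
theorem frameChart_graphPlane {k n : ℕ} (A : Frame k n) (X : Model k n) :
    frameChart A (graphPlane A X) = X :=
  Function.leftInverse_invFun (graphPlane_injective A) X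

theorem exists_graphPlane {k n : ℕ} (P : Gr k n) :
    ∃ (A : Frame k n) (X : Model k n), graphPlane A X = P :=
  exists_frame P

theorem frameChart_mdifferentiable {k n : ℕ} (A : Frame k n) :
    (frameChart A).MDifferentiable 𝓘(ℝ, Model k n) 𝓘(ℝ, Model k n) :=
  haveI : IsManifold 𝓘(ℝ, Model k n) 1 (Gr k n) := IsManifold.of_le (n := ∞) (by simp)
  mdifferentiable_of_mem_atlas (frameChart_mem_atlas A)

/-- The target of a graph chart is the whole model space, so its inverse is differentiable with no
domain condition. -/
theorem mdifferentiableAt_graphPlane {k n : ℕ} (A : Frame k n) (X : Model k n) :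
    MDifferentiableAt 𝓘(ℝ, Model k n) 𝓘(ℝ, Model k n) (graphPlane A) X :=
  (frameChart_mdifferentiable A).mdifferentiableAt_symm (Set.mem_univ X)

theorem continuous_graphPlane {k n : ℕ} (A : Frame k n) : Continuous (graphPlane A) :=
  continuous_iff_continuousAt.2 fun X => (mdifferentiableAt_graphPlane A X).continuousAt

/-- The tangent vector of `G(k,n)` with coordinates `Y` at the point with coordinates `X` in the
graph chart of `A`. -/
def graphVelocity {k n : ℕ} (A : Frame k n) (X Y : Model k n) : TGr k n :=
  ⟨graphPlane A X, mfderiv 𝓘(ℝ, Model k n) 𝓘(ℝ, Model k n) (graphPlane A) X Y⟩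

theorem graphVelocity_injective {k n : ℕ} (A : Frame k n) (X : Model k n) :
    Function.Injective (graphVelocity A X) := by
  intro Y Z h
  have h' := eq_of_heq (Bundle.TotalSpace.mk.inj h).2
  exact (frameChart_mdifferentiable A).symm.mfderiv_injective (Set.mem_univ X) h'

theorem exists_graphVelocity_eq {k n : ℕ} (A : Frame k n) (X : Model k n) (v : TGr k n)
    (hv : v.1 = graphPlane A X) : ∃ Y, graphVelocity A X Y = v := by
  obtain ⟨P, u⟩ := v
  obtain rfl : P = graphPlane A X := hv
  obtain ⟨Y, hY⟩ := (frameChart_mdifferentiable A).symm.mfderiv_surjective (Set.mem_univ X) u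
  exact ⟨Y, congrArg (Bundle.TotalSpace.mk _) hY⟩

theorem velocity_eq_graphVelocity {k n : ℕ} (A : Frame k n) {γ : ℝ → Gr k n} {X : ℝ → Model k n}
    {Y : Model k n} {t : ℝ} (hX : HasDerivAt X Y t)
    (hγ : γ =ᶠ[nhds t] fun s => graphPlane A (X s)) :
    velocity γ t = graphVelocity A (X t) Y := by
  have h1 : velocity γ t = velocity (graphPlane A ∘ X) t := by
    unfold velocity
    have h2 := hγ.mfderiv_eq (I := 𝓘(ℝ, ℝ)) (I' := 𝓘(ℝ, Model k n))
    have h3 := hγ.self_of_nhds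
    rw [Bundle.TotalSpace.mk.injEq]
    refine ⟨h3, ?_⟩
    rw [h2]
    rfl
  rw [h1]
  have h4 : HasMFDerivAt 𝓘(ℝ, ℝ) 𝓘(ℝ, Model k n) X t _ := hX.hasFDerivAt.hasMFDerivAt
  have h5 := ((mdifferentiableAt_graphPlane A (X t)).hasMFDerivAt.comp t h4).mfderiv
  unfold velocity graphVelocity
  rw [h5]
  exact congrArg (Bundle.TotalSpace.mk _)
    (congrArg (mfderiv 𝓘(ℝ, Model k n) 𝓘(ℝ, Model k n) (graphPlane A) (X t)) (one_smul ℝ Y))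

theorem finrank_map_of_injective {V V' : Type*} [AddCommGroup V] [Module ℝ V] [AddCommGroup V']
    [Module ℝ V'] {i : V →ₗ[ℝ] V'} (hi : Function.Injective i) (p : Submodule ℝ V) :
    Module.finrank ℝ (p.map i) = Module.finrank ℝ p :=
  (p.equivMapOfInjective i hi).finrank_eq.symm

/-! ### The planes orthogonal to a subspace -/

/-- `Φ` carries `ℝᵐ × 0` onto `Wᗮ`. Only this is used later, so the identification `ℝᵐ ≅ Wᗮ` need
not be isometric. -/
theorem exists_splitting {m n : ℕ} (hmn : m ≤ n) (W : Submodule ℝ (E n))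
    (hW : Module.finrank ℝ W = n - m) :
    ∃ Φ : (E m × W) ≃L[ℝ] E n, ∀ z, z ∈ Wᗮ ↔ (Φ.symm z).2 = 0 := by
  have h2 : Module.finrank ℝ Wᗮ = m := by
    have := W.finrank_add_finrank_orthogonal
    simp only [finrank_euclideanSpace, Fintype.card_fin] at this
    omega
  let e : E m ≃ₗ[ℝ] Wᗮ := LinearEquiv.ofFinrankEq _ _ (by simp [h2])
  let Φ : (E m × W) ≃ₗ[ℝ] E n := (e.prodCongr (LinearEquiv.refl ℝ W)).trans
    (Submodule.prodEquivOfIsCompl Wᗮ W W.isCompl_orthogonal.symm)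
  refine ⟨Φ.toContinuousLinearEquiv, fun z => ?_⟩
  change _ ↔ (((Submodule.prodEquivOfIsCompl Wᗮ W W.isCompl_orthogonal.symm).symm z).2 : W) = 0
  rw [Submodule.prodEquivOfIsCompl_symm_apply_snd_eq_zero]

variable {k m n : ℕ} {W : Submodule ℝ (E n)}

/-- The map `G(k,m) → G(k,n)` induced by the embedding of `ℝᵐ` as the first summand of `ℝⁿ`. -/
def pushPlane (k : ℕ) (Φ : (E m × W) ≃L[ℝ] E n) (Q : Gr k m) : Gr k n :=
  ⟨Q.1.map (Φ.toLinearMap.comp (LinearMap.inl ℝ (E m) W)), by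
    rw [finrank_map_of_injective, Q.2]
    exact Φ.injective.comp LinearMap.inl_injective⟩

theorem mem_pushPlane (Φ : (E m × W) ≃L[ℝ] E n) (Q : Gr k m) (z : E n) :
    z ∈ (pushPlane k Φ Q).1 ↔ (Φ.symm z).1 ∈ Q.1 ∧ (Φ.symm z).2 = 0 := by
  constructor
  · rintro ⟨x, hx, rfl⟩
    simpa using hx
  · rintro ⟨h1, h2⟩
    refine ⟨_, h1, ?_⟩
    have : Φ ((Φ.symm z).1, (Φ.symm z).2) = z := by simp
    rw [h2] at this
    simpa using this

theorem pushPlane_injective (Φ : (E m × W) ≃L[ℝ] E n) : Function.Injective (pushPlane k Φ) := by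
  intro Q R h
  apply Subtype.ext
  ext x
  have h1 := mem_pushPlane Φ Q (Φ (x, 0))
  have h2 := mem_pushPlane Φ R (Φ (x, 0))
  rw [h, h2] at h1
  simpa using h1.symm

theorem mem_planesOrthogonalTo_iff (P : Gr k n) :
    P ∈ planesOrthogonalTo k W ↔ P.1 ≤ Wᗮ :=
  Submodule.isOrtho_iff_le

theorem range_pushPlane (Φ : (E m × W) ≃L[ℝ] E n) (hΦ : ∀ z, z ∈ Wᗮ ↔ (Φ.symm z).2 = 0) :
    Set.range (pushPlane k Φ) = planesOrthogonalTo k W := by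
  ext P
  rw [mem_planesOrthogonalTo_iff]
  constructor
  · rintro ⟨Q, rfl⟩ z hz
    exact (hΦ z).2 ((mem_pushPlane Φ Q z).1 hz).2
  · intro h
    let i : E m →ₗ[ℝ] E n := Φ.toLinearMap.comp (LinearMap.inl ℝ (E m) W)
    have hi : Function.Injective i := Φ.injective.comp LinearMap.inl_injective
    have hmap : (P.1.comap i).map i = P.1 := by
      refine Submodule.map_comap_eq_self fun z hz => ⟨(Φ.symm z).1, ?_⟩
      have : Φ ((Φ.symm z).1, (Φ.symm z).2) = z := by simp
      rw [(hΦ z).1 (h hz)] at this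
      simpa [i] using this
    refine ⟨⟨P.1.comap i, ?_⟩, Subtype.ext hmap⟩
    rw [← finrank_map_of_injective hi, hmap, P.2]

/-- The frame of `ℝⁿ` obtained from a frame of `ℝᵐ` by appending a complement of `ℝᵐ`. -/
def extendFrame (Φ : (E m × W) ≃L[ℝ] E n) (e : E (n - k) ≃L[ℝ] E (m - k) × W) (A : Frame k m) :
    Frame k n :=
  (((ContinuousLinearEquiv.refl ℝ (E k)).prodCongr e).trans
    ((ContinuousLinearEquiv.prodAssoc ℝ (E k) (E (m - k)) W).symm.trans
      (A.prodCongr (ContinuousLinearEquiv.refl ℝ W)))).trans Φ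

theorem extendFrame_symm_apply (Φ : (E m × W) ≃L[ℝ] E n) (e : E (n - k) ≃L[ℝ] E (m - k) × W)
    (A : Frame k m) (z : E n) :
    (extendFrame Φ e A).symm z =
      ((A.symm (Φ.symm z).1).1, e.symm ((A.symm (Φ.symm z).1).2, (Φ.symm z).2)) := rfl

/-- The splitting of the model space of `G(k,n)` into the model space of `G(k,m)` and the maps to
the complement. -/
def modelSplit (e : E (n - k) ≃L[ℝ] E (m - k) × W) :
    (Model k m × (E k →L[ℝ] W)) ≃L[ℝ] Model k n :=
  (ContinuousLinearMap.prodL ℝ).trans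
    ((ContinuousLinearEquiv.refl ℝ (E k)).arrowCongr e.symm)

@[simp]
theorem modelSplit_apply (e : E (n - k) ≃L[ℝ] E (m - k) × W) (X : Model k m) (Z : E k →L[ℝ] W)
    (v : E k) : modelSplit e (X, Z) v = e.symm (X v, Z v) := rfl

theorem pushPlane_graphPlane (Φ : (E m × W) ≃L[ℝ] E n) (e : E (n - k) ≃L[ℝ] E (m - k) × W)
    (A : Frame k m) (X : Model k m) :
    pushPlane k Φ (graphPlane A X) = graphPlane (extendFrame Φ e A) (modelSplit e (X, 0)) := by
  apply Subtype.ext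
  ext z
  rw [mem_pushPlane]
  refine (and_congr_left' (mem_graphSub A X _)).trans
    (Iff.trans ?_ (mem_graphSub (extendFrame Φ e A) _ z).symm)
  rw [extendFrame_symm_apply, modelSplit_apply, e.symm.injective.eq_iff, Prod.mk_inj]
  rfl

/-- The graph point over `v` has as its `W`-component the second part of `Z v`, which must vanish
when the plane lies in `Wᗮ`. -/
theorem modelSplit_snd_eq_zero (Φ : (E m × W) ≃L[ℝ] E n) (hΦ : ∀ z, z ∈ Wᗮ ↔ (Φ.symm z).2 = 0)
    (e : E (n - k) ≃L[ℝ] E (m - k) × W) (A : Frame k m) (Z : Model k n)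
    (hZ : graphPlane (extendFrame Φ e A) Z ∈ planesOrthogonalTo k W) :
    ((modelSplit e).symm Z).2 = 0 := by
  obtain ⟨⟨X, Y⟩, rfl⟩ := (modelSplit e).surjective Z
  rw [ContinuousLinearEquiv.symm_apply_apply]
  ext1 v
  set z := extendFrame Φ e A (v, modelSplit e (X, Y) v)
  have hz : z ∈ (graphPlane (extendFrame Φ e A) (modelSplit e (X, Y))).1 :=
    (mem_graphSub _ _ _).2 (by simp [z])
  have h1 := (hΦ z).1 ((mem_planesOrthogonalTo_iff _).1 hZ hz)
  have h2 : (extendFrame Φ e A).symm z = (v, modelSplit e (X, Y) v) := by simp [z]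
  rw [extendFrame_symm_apply, modelSplit_apply, Prod.mk_inj, e.symm.injective.eq_iff,
    Prod.mk_inj] at h2
  rw [← h2.2.2, h1]
  rfl

/-! ### Smooth embedding and tangent vectors of the planes orthogonal to `W`. -/

theorem exists_model_splitting (Φ : (E m × W) ≃L[ℝ] E n) (Q : Gr k m) :
    Nonempty (E (n - k) ≃L[ℝ] E (m - k) × W) := by
  have h1 : k ≤ m := le_of_gr Q
  have h2 : m + Module.finrank ℝ W = n := by
    simpa using Φ.toLinearEquiv.finrank_eq
  refine ⟨(LinearEquiv.ofFinrankEq _ _ ?_).toContinuousLinearEquiv⟩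
  simp only [finrank_euclideanSpace, Fintype.card_fin, Module.finrank_prod]
  omega

theorem isImmersion_pushPlane (k : ℕ) (Φ : (E m × W) ≃L[ℝ] E n) :
    Manifold.IsImmersion 𝓘(ℝ, Model k m) 𝓘(ℝ, Model k n) ∞ (pushPlane k Φ) := by
  -- The normal directions are the maps from the plane to `W`, so one complement serves at every
  -- point.
  refine Manifold.IsImmersionOfComplement.isImmersion (F := E k →L[ℝ] W) fun Q => ?_
  obtain ⟨e⟩ := exists_model_splitting Φ Q
  obtain ⟨A, X, rfl⟩ := exists_graphPlane Q
  refine Manifold.IsImmersionAtOfComplement.mk_of_charts (modelSplit e) (frameChart A)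
    (frameChart (extendFrame Φ e A)) ⟨X, rfl⟩ ⟨_, (pushPlane_graphPlane Φ e A X).symm⟩
    (frameChart_mem_maximalAtlas A) (frameChart_mem_maximalAtlas _) ?_ ?_
  · rintro _ ⟨Y, rfl⟩
    exact ⟨_, (pushPlane_graphPlane Φ e A Y).symm⟩
  · intro Y _
    simp [pushPlane_graphPlane Φ e A Y]

/-- Near a point of the image, reading the chart and dropping the `W`-coordinate gives a continuous
map `r` back to `G(k,m)`. It inverts `pushPlane` on the preimage of the whole chart domain, so the
topology of `G(k,m)` is induced. -/
theorem isEmbedding_pushPlane (Φ : (E m × W) ≃L[ℝ] E n)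
    (hΦ : ∀ z, z ∈ Wᗮ ↔ (Φ.symm z).2 = 0) : Topology.IsEmbedding (pushPlane k Φ) := by
  refine ⟨Topology.isInducing_iff_nhds.2 fun Q => le_antisymm ?_ ?_, pushPlane_injective Φ⟩
  · exact ((isImmersion_pushPlane k Φ).contMDiff.continuous.tendsto Q).le_comap
  obtain ⟨e⟩ := exists_model_splitting Φ Q
  obtain ⟨A, X, rfl⟩ := exists_graphPlane Q
  set B := extendFrame Φ e A
  let r : Gr k n → Gr k m := fun P => graphPlane A ((modelSplit e).symm (frameChart B P)).1
  have hmem : pushPlane k Φ (graphPlane A X) ∈ (frameChart B).source :=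
    ⟨_, (pushPlane_graphPlane Φ e A X).symm⟩
  have hr : ContinuousAt r (pushPlane k Φ (graphPlane A X)) :=
    (continuous_graphPlane A).continuousAt.comp
      ((continuous_fst.comp (modelSplit e).symm.continuous).continuousAt.comp
        ((frameChart B).continuousAt hmem))
  have hrX : ∀ Y, r (pushPlane k Φ (graphPlane A Y)) = graphPlane A Y := by
    intro Y
    simp [r, pushPlane_graphPlane Φ e A Y, B]
  have hev : ∀ᶠ R in Filter.comap (pushPlane k Φ) (nhds (pushPlane k Φ (graphPlane A X))),
      r (pushPlane k Φ R) = R := by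
    filter_upwards [Filter.preimage_mem_comap ((frameChart B).open_source.mem_nhds hmem)]
    rintro R ⟨Z, hZ⟩
    change graphPlane B Z = pushPlane k Φ R at hZ
    -- The image lies in `N`, so its coordinate has no `W`-part and comes from a plane in the chart
    -- of `A`; injectivity identifies that plane with `R`.
    have h0 := modelSplit_snd_eq_zero Φ hΦ e A Z (by
      rw [← range_pushPlane Φ hΦ]
      exact ⟨R, hZ.symm⟩)
    have hZ' : Z = modelSplit e (((modelSplit e).symm Z).1, 0) := by
      rw [← h0]; simp
    rw [hZ', ← pushPlane_graphPlane] at hZ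
    rw [← pushPlane_injective Φ hZ, hrX]
  have ht : Filter.Tendsto (r ∘ pushPlane k Φ)
      (Filter.comap (pushPlane k Φ) (nhds (pushPlane k Φ (graphPlane A X))))
      (nhds (graphPlane A X)) := by
    rw [ContinuousAt, hrX] at hr
    exact hr.comp Filter.tendsto_comap
  exact Filter.tendsto_id'.1 (ht.congr' hev)

/-- Chain rule on both sides of `pushPlane_graphPlane`; the inclusion `i` is linear, hence its own
derivative. -/
theorem tangentMap_pushPlane (Φ : (E m × W) ≃L[ℝ] E n) (e : E (n - k) ≃L[ℝ] E (m - k) × W)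
    (A : Frame k m) (X Y : Model k m) :
    tangentMap 𝓘(ℝ, Model k m) 𝓘(ℝ, Model k n) (pushPlane k Φ) (graphVelocity A X Y) =
      graphVelocity (extendFrame Φ e A) (modelSplit e (X, 0)) (modelSplit e (Y, 0)) := by
  let i : Model k m →L[ℝ] Model k n :=
    (modelSplit e : _ →L[ℝ] Model k n).comp (ContinuousLinearMap.inl ℝ (Model k m) (E k →L[ℝ] W))
  have hcomp : pushPlane k Φ ∘ graphPlane A = graphPlane (extendFrame Φ e A) ∘ i :=
    funext fun X => pushPlane_graphPlane Φ e A X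
  have hp : MDifferentiableAt 𝓘(ℝ, Model k m) 𝓘(ℝ, Model k n) (pushPlane k Φ) (graphPlane A X) :=
    (isImmersion_pushPlane k Φ).contMDiff.mdifferentiableAt (by simp)
  have h1 := tangentMap_comp_at (I := 𝓘(ℝ, Model k m)) (I' := 𝓘(ℝ, Model k m))
    (I'' := 𝓘(ℝ, Model k n)) (f := graphPlane A) (g := pushPlane k Φ)
    (⟨X, Y⟩ : TangentBundle 𝓘(ℝ, Model k m) (Model k m)) hp (mdifferentiableAt_graphPlane A X)
  have h2 := tangentMap_comp_at (I := 𝓘(ℝ, Model k m)) (I' := 𝓘(ℝ, Model k n))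
    (I'' := 𝓘(ℝ, Model k n)) (f := i) (g := graphPlane (extendFrame Φ e A))
    (⟨X, Y⟩ : TangentBundle 𝓘(ℝ, Model k m) (Model k m))
    (mdifferentiableAt_graphPlane _ _) i.differentiableAt.mdifferentiableAt
  rw [hcomp, h2] at h1
  refine h1.symm.trans ?_
  have h3 : tangentMap 𝓘(ℝ, Model k m) 𝓘(ℝ, Model k n) i
      (⟨X, Y⟩ : TangentBundle 𝓘(ℝ, Model k m) (Model k m)) = ⟨i X, i Y⟩ := by
    simp only [tangentMap, mfderiv_eq_fderiv, i.fderiv]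
    rfl
  rw [h3]
  rfl

/-- The tangent bundle of the set of the planes orthogonal to `W`, in a graph chart. -/
theorem graphVelocity_mem_tangentBundleOf_iff (Φ : (E m × W) ≃L[ℝ] E n)
    (e : E (n - k) ≃L[ℝ] E (m - k) × W) (A : Frame k m) (X : Model k m) (Z : Model k n) :
    graphVelocity (extendFrame Φ e A) (modelSplit e (X, 0)) Z ∈
      tangentBundleOf (Model k m) (pushPlane k Φ) ↔ ∃ Y, Z = modelSplit e (Y, 0) := by
  constructor
  · rintro ⟨v, hv⟩
    -- Injectivity of `pushPlane` forces `v` to be based at the plane of `X`, where it has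
    -- coordinates in the chart of `A`.
    have hv1 : pushPlane k Φ v.1 = pushPlane k Φ (graphPlane A X) := by
      rw [pushPlane_graphPlane Φ e]
      exact congrArg Bundle.TotalSpace.proj hv
    obtain ⟨Y, rfl⟩ := exists_graphVelocity_eq A X v (pushPlane_injective Φ hv1)
    rw [tangentMap_pushPlane Φ e] at hv
    exact ⟨Y, (graphVelocity_injective _ _ hv).symm⟩
  · rintro ⟨Y, rfl⟩
    exact ⟨graphVelocity A X Y, tangentMap_pushPlane Φ e A X Y⟩

/-! ### Matrices acting on Euclidean space -/

/-- The operator on `ℝⁿ` given by a matrix. -/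
def act (M : Matrix (Fin n) (Fin n) ℝ) : E n →L[ℝ] E n :=
  Matrix.toEuclideanCLM (n := Fin n) (𝕜 := ℝ) M

theorem act_apply (M : Matrix (Fin n) (Fin n) ℝ) (x : E n) :
    act M x = WithLp.toLp 2 (M.mulVec x) := rfl

theorem act_mul (M N : Matrix (Fin n) (Fin n) ℝ) (x : E n) : act (M * N) x = act M (act N x) := by
  simp [act_apply, Matrix.mulVec_mulVec]

theorem act_one (x : E n) : act 1 x = x := by
  simp [act_apply]

theorem act_neg (M : Matrix (Fin n) (Fin n) ℝ) (x : E n) : act (-M) x = -act M x := by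
  ext i
  simp [act_apply, Matrix.neg_mulVec]

theorem inner_act_left (M : Matrix (Fin n) (Fin n) ℝ) (x y : E n) :
    inner ℝ (act M x) y = inner ℝ x (act M.transpose y) := by
  simp only [EuclideanSpace.inner_eq_star_dotProduct, act_apply, star_trivial]
  rw [Matrix.dotProduct_mulVec, Matrix.mulVec_transpose]

theorem act_act_inv (g : Matrix.orthogonalGroup (Fin n) ℝ) (x : E n) :
    act g (act (g⁻¹ : Matrix.orthogonalGroup (Fin n) ℝ) x) = x := by
  rw [← act_mul, ← Matrix.UnitaryGroup.mul_val, mul_inv_cancel]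
  exact act_one x

theorem act_inv_act (g : Matrix.orthogonalGroup (Fin n) ℝ) (x : E n) :
    act (g⁻¹ : Matrix.orthogonalGroup (Fin n) ℝ) (act g x) = x := by
  rw [← act_mul, ← Matrix.UnitaryGroup.mul_val, inv_mul_cancel]
  exact act_one x

theorem inner_act_orthogonal (g : Matrix.orthogonalGroup (Fin n) ℝ) (x y : E n) :
    inner ℝ (act g x) y = inner ℝ x (act (g⁻¹ : Matrix.orthogonalGroup (Fin n) ℝ) y) :=
  inner_act_left _ x y

/-- The operator of an orthogonal matrix as an automorphism of `ℝⁿ`. -/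
def actEquiv (g : Matrix.orthogonalGroup (Fin n) ℝ) : E n ≃L[ℝ] E n :=
  ContinuousLinearEquiv.equivOfInverse (act g) (act (g⁻¹ : Matrix.orthogonalGroup (Fin n) ℝ))
    (act_inv_act g) (act_act_inv g)

-- The norm is auxiliary: derivatives depend only on the topology of the matrix space.
attribute [local instance] Matrix.linftyOpNormedRing Matrix.linftyOpNormedAlgebra in
theorem hasDerivAt_act {h : ℝ → Matrix (Fin n) (Fin n) ℝ} {A : Matrix (Fin n) (Fin n) ℝ} {t : ℝ}
    (hh : HasDerivAt h A t) : HasDerivAt (fun s => act (h s)) (act A) t := by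
  let L : Matrix (Fin n) (Fin n) ℝ →L[ℝ] (E n →L[ℝ] E n) := LinearMap.toContinuousLinearMap
    { toFun := act
      map_add' := map_add (Matrix.toEuclideanCLM (n := Fin n) (𝕜 := ℝ))
      map_smul' := map_smul (Matrix.toEuclideanCLM (n := Fin n) (𝕜 := ℝ)) }
  exact L.hasFDerivAt.comp_hasDerivAt t hh

attribute [local instance] Matrix.linftyOpNormedRing Matrix.linftyOpNormedAlgebra in
theorem hasDerivAt_mul_exp_smul (B A : Matrix (Fin n) (Fin n) ℝ) (t : ℝ) :
    HasDerivAt (fun s : ℝ => B * NormedSpace.exp (s • A)) (B * NormedSpace.exp (t • A) * A) t := by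
  rw [mul_assoc]
  exact (hasDerivAt_exp_smul_const A t).const_mul B

attribute [local instance] Matrix.linftyOpNormedRing Matrix.linftyOpNormedAlgebra in
theorem eq_of_hasDerivAt_zero {X : ℝ → Matrix (Fin n) (Fin n) ℝ} (hX : ∀ t, HasDerivAt X 0 t)
    (s t : ℝ) : X s = X t :=
  is_const_of_deriv_eq_zero (fun t => (hX t).differentiableAt) (fun t => (hX t).deriv) s t

theorem exp_smul_mem_orthogonalGroup {A : Matrix (Fin n) (Fin n) ℝ}
    (hA : A ∈ LieAlgebra.Orthogonal.so (Fin n) ℝ) (t : ℝ) :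
    NormedSpace.exp (t • A) ∈ Matrix.orthogonalGroup (Fin n) ℝ := by
  rw [Matrix.mem_orthogonalGroup_iff', ← Matrix.exp_transpose, Matrix.transpose_smul,
    (LieAlgebra.Orthogonal.mem_so _ _ _).1 hA, smul_neg,
    ← Matrix.exp_add_of_commute (-(t • A)) (t • A) (Commute.neg_left (Commute.refl (t • A)))]
  simp

/-! ### The origin and the standard frame -/

theorem mem_origin_iff (x : E n) : x ∈ origin k n ↔ ∀ i : Fin n, k ≤ (i : ℕ) → x i = 0 := by
  constructor
  · intro hx i hi
    induction hx using Submodule.span_induction with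
    | mem y hy =>
      obtain ⟨j, hj, rfl⟩ := hy
      have : i ≠ j := by rintro rfl; omega
      simp [this]
    | zero => rfl
    | add y z _ _ hy hz => simp [hy, hz]
    | smul c y _ hy => simp [hy]
  · intro h
    have hx : x = ∑ i, x i • EuclideanSpace.single i (1 : ℝ) := by
      ext j
      simp [Finset.sum_apply, Pi.single_apply]
    rw [hx]
    refine Submodule.sum_mem _ fun i _ => ?_
    by_cases hi : (i : ℕ) < k
    · exact Submodule.smul_mem _ _ (Submodule.subset_span ⟨i, hi, rfl⟩)
    · rw [h i (by omega), zero_smul]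
      exact zero_mem _

theorem act_S_apply (x : E n) (i : Fin n) :
    act (S k n) x i = (if (i : ℕ) < k then -1 else 1) * x i := by
  simp only [act_apply, S, Matrix.mulVec_diagonal]

theorem mem_origin_iff_act_S (x : E n) : x ∈ origin k n ↔ act (S k n) x = -x := by
  rw [mem_origin_iff, PiLp.ext_iff]
  refine forall_congr' fun i => ?_
  rw [act_S_apply]
  by_cases hi : (i : ℕ) < k
  · simp [hi]
  · simp only [hi, not_lt.1 hi, if_false, forall_const, PiLp.neg_apply]
    constructor <;> intro h <;> linarith

theorem S_transpose : (S k n).transpose = S k n := Matrix.diagonal_transpose _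

theorem S_mul_S : S k n * S k n = 1 := by
  rw [S, Matrix.diagonal_mul_diagonal, ← Matrix.diagonal_one]
  congr 1
  ext i
  split_ifs <;> simp

theorem act_S_act_S (x : E n) : act (S k n) (act (S k n) x) = x := by
  rw [← act_mul, S_mul_S, act_one]

/-- The vector `d = Sx - x` satisfies `Sd = -d`, so it lies in `o` and is orthogonal to `x`. By
symmetry of `S` it is also orthogonal to `Sx`, hence to itself. -/
theorem act_S_of_orthogonal {x : E n} (hx : x ∈ (origin k n)ᗮ) : act (S k n) x = x := by
  have h1 : act (S k n) x - x ∈ origin k n := by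
    rw [mem_origin_iff_act_S, map_sub, act_S_act_S, neg_sub]
  have h2 := (Submodule.mem_orthogonal _ _).1 hx _ h1
  have h3 : inner ℝ (act (S k n) x - x) (act (S k n) x) = (0 : ℝ) := by
    have h4 := (mem_origin_iff_act_S _).1 h1
    have h5 : inner ℝ (act (S k n) (act (S k n) x - x)) x =
        (inner ℝ (act (S k n) x - x) (act (S k n) x) : ℝ) := by
      rw [inner_act_left, S_transpose]
    rw [← h5, h4, inner_neg_left, h2, neg_zero]
  rw [← sub_eq_zero, ← inner_self_eq_zero (𝕜 := ℝ)]
  rw [inner_sub_right, h3, h2, sub_zero]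

theorem S_mul_of_mem_mSpace {A : Matrix (Fin n) (Fin n) ℝ} (hA : A ∈ mSpace k n) :
    S k n * A = -(A * S k n) := by
  rw [← mul_one (S k n * A), ← S_mul_S (k := k), ← mul_assoc, hA.2, neg_mul]

/-- `A` anticommutes with `S`, so it sends the `(+1)`-eigenspace `oᗮ` into the `(-1)`-eigenspace
`o`. -/
theorem act_mem_origin {A : Matrix (Fin n) (Fin n) ℝ} (hA : A ∈ mSpace k n) {x : E n}
    (hx : x ∈ (origin k n)ᗮ) : act A x ∈ origin k n := by
  rw [mem_origin_iff_act_S, ← act_mul, S_mul_of_mem_mSpace hA, act_neg, act_mul,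
    act_S_of_orthogonal hx]

/-- The splitting of the coordinates of `ℝⁿ` into the first `k` and the last `n - k`. -/
def splitFin (hk : k ≤ n) : Fin k ⊕ Fin (n - k) ≃ Fin n :=
  finSumFinEquiv.trans (finCongr (Nat.add_sub_of_le hk))

theorem splitFin_inl (hk : k ≤ n) (i : Fin k) : (splitFin hk (Sum.inl i) : ℕ) = i := rfl

theorem splitFin_inr (hk : k ≤ n) (i : Fin (n - k)) : (splitFin hk (Sum.inr i) : ℕ) = k + i := rfl

/-- The standard frame of `ℝⁿ`. -/
def stdFrame (hk : k ≤ n) : Frame k n :=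
  LinearEquiv.toContinuousLinearEquiv
    { toFun := fun p => WithLp.toLp 2 fun i => Sum.elim p.1 p.2 ((splitFin hk).symm i)
      invFun := fun x => (WithLp.toLp 2 fun i => x (splitFin hk (Sum.inl i)),
        WithLp.toLp 2 fun i => x (splitFin hk (Sum.inr i)))
      left_inv := fun p => by simp
      right_inv := fun x => by
        ext i
        obtain ⟨i | i, rfl⟩ := (splitFin hk).surjective i <;> simp
      map_add' := fun p q => by
        ext i
        obtain ⟨i | i, rfl⟩ := (splitFin hk).surjective i <;> simp
      map_smul' := fun c p => by
        ext i
        obtain ⟨i | i, rfl⟩ := (splitFin hk).surjective i <;> simp }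

theorem stdFrame_apply_inl (hk : k ≤ n) (v : E k) (w : E (n - k)) (i : Fin k) :
    stdFrame hk (v, w) (splitFin hk (Sum.inl i)) = v i := by
  change Sum.elim v w ((splitFin hk).symm _) = _
  simp

theorem stdFrame_apply_inr (hk : k ≤ n) (v : E k) (w : E (n - k)) (i : Fin (n - k)) :
    stdFrame hk (v, w) (splitFin hk (Sum.inr i)) = w i := by
  change Sum.elim v w ((splitFin hk).symm _) = _
  simp

theorem graphPlane_stdFrame_zero (hk : k ≤ n) :
    (graphPlane (stdFrame hk) 0).1 = origin k n := by
  ext x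
  refine (mem_graphSub _ _ _).trans ?_
  rw [mem_origin_iff, PiLp.ext_iff]
  constructor
  · intro h i hi
    obtain ⟨i | i, rfl⟩ := (splitFin hk).surjective i
    · have := splitFin_inl hk i
      omega
    · exact h i
  · intro h i
    exact h (splitFin hk (Sum.inr i)) (by rw [splitFin_inr]; omega)

theorem stdFrame_mem_origin (hk : k ≤ n) (v : E k) : stdFrame hk (v, 0) ∈ origin k n := by
  rw [← graphPlane_stdFrame_zero hk]
  exact (mem_graphSub _ _ _).2 (by simp)

theorem orbit_eq_map (g : Matrix.orthogonalGroup (Fin n) ℝ) :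
    orbit k g = (origin k n).map (actEquiv g).toLinearMap := rfl

theorem mem_orbit_iff (g : Matrix.orthogonalGroup (Fin n) ℝ) (x : E n) :
    x ∈ orbit k g ↔ act (g⁻¹ : Matrix.orthogonalGroup (Fin n) ℝ) x ∈ origin k n := by
  rw [orbit_eq_map, Submodule.mem_map]
  constructor
  · rintro ⟨y, hy, hyx⟩
    have hyx' : act g y = x := hyx
    rwa [← hyx', act_inv_act]
  · intro h
    exact ⟨_, h, act_act_inv g x⟩

theorem act_mem_orbit (g : Matrix.orthogonalGroup (Fin n) ℝ) {x : E n} (hx : x ∈ origin k n) :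
    act g x ∈ orbit k g := by
  rwa [mem_orbit_iff, act_inv_act]

/-- The image of the standard frame under an orthogonal matrix. -/
def orthFrame (hk : k ≤ n) (g : Matrix.orthogonalGroup (Fin n) ℝ) : Frame k n :=
  (stdFrame hk).trans (actEquiv g)

theorem graphPlane_orthFrame_zero (hk : k ≤ n) (g : Matrix.orthogonalGroup (Fin n) ℝ) :
    (graphPlane (orthFrame hk g) 0).1 = orbit k g := by
  ext x
  refine (mem_graphSub _ _ _).trans (Iff.trans ?_ (mem_orbit_iff g x).symm)
  rw [← graphPlane_stdFrame_zero hk]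
  exact (mem_graphSub (stdFrame hk) 0 _).symm

theorem finrank_origin (hk : k ≤ n) : Module.finrank ℝ (origin k n) = k := by
  rw [← graphPlane_stdFrame_zero hk]
  exact (graphPlane (stdFrame hk) 0).2

/-- `O(n)` acts transitively on `G(k,n)`. -/
theorem exists_orbit_eq (P : Gr k n) :
    ∃ g : Matrix.orthogonalGroup (Fin n) ℝ, P.1 = orbit k g := by
  have hk : k ≤ n := le_of_gr P
  let e : origin k n ≃ₗᵢ[ℝ] P.1 :=
    ((stdOrthonormalBasis ℝ (origin k n)).reindex <| finCongr (finrank_origin hk)).repr.trans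
      ((stdOrthonormalBasis ℝ P.1).reindex <| finCongr P.2).repr.symm
  -- An isometry of `o` onto `P` extends to all of `ℝⁿ`; the matrix of the extension preserves inner
  -- products, so it is orthogonal.
  let L : E n →ₗᵢ[ℝ] E n := (P.1.subtypeₗᵢ.comp e.toLinearIsometry).extend
  have hL : ∀ x : origin k n, L x = e x := fun x => LinearIsometry.extend_apply _ x
  obtain ⟨M, hM⟩ := (Matrix.toEuclideanCLM (n := Fin n) (𝕜 := ℝ)).surjective L.toContinuousLinearMap
  have hM' : ∀ x, act M x = L x := fun x => congrArg (fun f : E n →L[ℝ] E n => f x) hM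
  have hMM : M ∈ Matrix.orthogonalGroup (Fin n) ℝ := by
    rw [Matrix.mem_orthogonalGroup_iff']
    refine (Matrix.toEuclideanCLM (n := Fin n) (𝕜 := ℝ)).injective ?_
    ext1 x
    refine ext_inner_left ℝ fun y => ?_
    change inner ℝ y (act (M.transpose * M) x) = inner ℝ y (act 1 x)
    rw [act_mul, ← inner_act_left, hM', hM', L.inner_map_map, act_one]
  refine ⟨⟨M, hMM⟩, ?_⟩
  ext x
  rw [orbit_eq_map, Submodule.mem_map]
  constructor
  · intro hx
    refine ⟨e.symm ⟨x, hx⟩, (e.symm ⟨x, hx⟩).2, ?_⟩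
    refine (hM' _).trans ?_
    rw [hL]
    simp
  · rintro ⟨y, hy, hyx⟩
    have hyx' : L y = x := (hM' y).symm.trans hyx
    rw [← hyx', hL ⟨y, hy⟩]
    exact (e ⟨y, hy⟩).2

/-- The block matrix `m(Y)` with the blocks `0, -Yᵀ; Y, 0`. -/
theorem exists_mem_mSpace (hk : k ≤ n) (Y : Model k n) :
    ∃ A ∈ mSpace k n, ∀ v, act A (stdFrame hk (v, 0)) = stdFrame hk (0, Y v) := by
  let R : Matrix (Fin (n - k)) (Fin k) ℝ := Matrix.of fun i j => Y (EuclideanSpace.single j 1) i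
  have hR : ∀ (v : E k) i, (R.mulVec v) i = Y v i := by
    intro v i
    have hv : v = ∑ j, v j • EuclideanSpace.single j (1 : ℝ) := by
      ext j
      simp [Finset.sum_apply, Pi.single_apply]
    conv_rhs => rw [hv]
    simp [R, Matrix.mulVec, dotProduct, mul_comm]
  let B : Matrix (Fin k ⊕ Fin (n - k)) (Fin k ⊕ Fin (n - k)) ℝ :=
    Matrix.fromBlocks 0 (-R.transpose) R 0
  let s := splitFin hk
  refine ⟨B.submatrix s.symm s.symm, ⟨?_, ?_⟩, fun v => ?_⟩
  · rw [LieAlgebra.Orthogonal.mem_so, Matrix.transpose_submatrix, Matrix.fromBlocks_transpose]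
    ext i j
    obtain ⟨i | i, rfl⟩ := s.surjective i <;> obtain ⟨j | j, rfl⟩ := s.surjective j <;> simp [B]
  · ext i j
    rw [S, Matrix.mul_diagonal, Matrix.diagonal_mul]
    obtain ⟨i | i, rfl⟩ := s.surjective i <;> obtain ⟨j | j, rfl⟩ := s.surjective j <;>
      simp [B, s, splitFin_inl, splitFin_inr]
  · ext i
    have h1 : act (B.submatrix s.symm s.symm) (stdFrame hk (v, 0)) i =
        B.mulVec (Sum.elim v 0) (s.symm i) := by
      rw [act_apply, Matrix.submatrix_mulVec_equiv]
      simp only [Function.comp_apply]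
      refine congrFun (congrArg B.mulVec (funext fun j => ?_)) _
      obtain j | j := j
      · exact stdFrame_apply_inl hk v 0 j
      · exact stdFrame_apply_inr hk v 0 j
    rw [h1, Matrix.fromBlocks_mulVec]
    obtain ⟨i | i, rfl⟩ := s.surjective i
    · rw [stdFrame_apply_inl]
      simp
    · rw [stdFrame_apply_inr, ← hR]
      simp [Function.comp_def]

/-! ### Geodesics -/

/-- A curve `h(t)·o` in a graph chart. -/
theorem exists_hasDerivAt_graphPlane {γ : ℝ → Gr k n}
    {h : ℝ → Matrix.orthogonalGroup (Fin n) ℝ} {D : Matrix (Fin n) (Fin n) ℝ}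
    (hγ : ∀ t, (γ t).1 = orbit k (h t))
    (hh : HasDerivAt (fun s => (h s : Matrix (Fin n) (Fin n) ℝ)) D 0)
    (B : Frame k n) {X₀ : Model k n} (h₀ : γ 0 = graphPlane B X₀) :
    ∃ (X : ℝ → Model k n) (X' : Model k n), X 0 = X₀ ∧ HasDerivAt X X' 0 ∧
      (γ =ᶠ[nhds 0] fun t => graphPlane B (X t)) ∧
      ∀ x ∈ origin k n, (B.symm (act D x)).2 =
        X' (B.symm (act (h 0) x)).1 + X₀ (B.symm (act D x)).1 := by
  have hk : k ≤ n := le_of_gr (γ 0)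
  have hγF : ∀ t, γ t = graphPlane (orthFrame hk (h t)) 0 := fun t =>
    Subtype.ext ((hγ t).trans (graphPlane_orthFrame_zero hk (h t)).symm)
  let c : E k →L[ℝ] E n := (stdFrame hk : _ →L[ℝ] E n).comp
    (ContinuousLinearMap.inl ℝ (E k) (E (n - k)))
  let b₁ : E n →L[ℝ] E k := (ContinuousLinearMap.fst ℝ (E k) (E (n - k))).comp
    (B.symm : E n →L[ℝ] (E k × E (n - k)))
  let b₂ : E n →L[ℝ] E (n - k) := (ContinuousLinearMap.snd ℝ (E k) (E (n - k))).comp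
    (B.symm : E n →L[ℝ] (E k × E (n - k)))
  let p : ℝ → E k →L[ℝ] E k := fun t => b₁.comp ((act (h t)).comp c)
  let q : ℝ → E k →L[ℝ] E (n - k) := fun t => b₂.comp ((act (h t)).comp c)
  have hp : ∀ t, pMap (orthFrame hk (h t)) B 0 = p t := fun t => by
    ext1 v
    rw [pMap_apply]
    rfl
  have hq : ∀ t, qMap (orthFrame hk (h t)) B 0 = q t := fun t => by
    ext1 v
    rw [qMap_apply]
    rfl
  have hact := hasDerivAt_act hh
  have hp' : HasDerivAt p (b₁.comp ((act D).comp c)) 0 := by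
    have := (hasDerivAt_const (0 : ℝ) b₁).clm_comp (hact.clm_comp (hasDerivAt_const (0 : ℝ) c))
    simpa using this
  have hq' : HasDerivAt q (b₂.comp ((act D).comp c)) 0 := by
    have := (hasDerivAt_const (0 : ℝ) b₂).clm_comp (hact.clm_comp (hasDerivAt_const (0 : ℝ) c))
    simpa using this
  -- In the chart of `B` the plane `h(t)·o` has coordinate `q(t) p(t)⁻¹`, where `p` and `q` are the
  -- components of `B⁻¹ h(t)` on `o`.
  have key : ∀ t X, γ t = graphPlane B X ↔
      IsUnit (p t) ∧ X = (q t).comp (Ring.inverse (p t)) := fun t X => by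
    rw [hγF, graphPlane_eq_iff, hp, hq]
  obtain ⟨hu, hX₀⟩ := (key 0 X₀).1 h₀
  have hinv : DifferentiableAt ℝ (fun t => Ring.inverse (p t)) 0 := by
    obtain ⟨u, hu⟩ := hu
    have h1 := hasFDerivAt_ringInverse (𝕜 := ℝ) u
    rw [hu] at h1
    exact (h1.comp_hasDerivAt (0 : ℝ) hp').differentiableAt
  let X : ℝ → Model k n := fun t => (q t).comp (Ring.inverse (p t))
  have hX : HasDerivAt X (deriv X 0) 0 :=
    (hq'.clm_comp hinv.hasDerivAt).differentiableAt.hasDerivAt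
  have hev : ∀ᶠ t in nhds (0 : ℝ), IsUnit (p t) :=
    hp'.continuousAt.eventually (Units.isOpen.mem_nhds hu)
  refine ⟨X, deriv X 0, hX₀.symm, hX, hev.mono fun t ht => (key t _).2 ⟨ht, rfl⟩, ?_⟩
  -- Differentiating `q = X p` gives `q' = X' p + X p'`, the claimed relation, without a formula for
  -- the derivative of `p⁻¹`.
  have hqX : q =ᶠ[nhds 0] fun t => (X t).comp (p t) := hev.mono fun t ht => by
    have h1 := Ring.inverse_mul_cancel _ ht
    change (Ring.inverse (p t)).comp (p t) = _ at h1
    simp only [X]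
    rw [ContinuousLinearMap.comp_assoc, h1]
    rfl
  have hder := hq'.unique ((hX.clm_comp hp').congr_of_eventuallyEq hqX)
  intro x hx
  rw [← graphPlane_stdFrame_zero hk] at hx
  have hx' : x = c ((stdFrame hk).symm x).1 := by
    have h1 := (mem_graphSub (stdFrame hk) 0 x).1 hx
    change x = stdFrame hk (((stdFrame hk).symm x).1, 0)
    rw [show (0 : E (n - k)) = ((stdFrame hk).symm x).2 from h1.symm]
    simp
  have h2 := congrArg (fun f : E k →L[ℝ] E (n - k) => f ((stdFrame hk).symm x).1) hder
  simp only [ContinuousLinearMap.comp_apply, add_apply, p] at h2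
  rw [← hx'] at h2
  have h3 : X 0 = X₀ := hX₀.symm
  rw [h3] at h2
  exact h2

attribute [local instance] Matrix.linftyOpNormedRing Matrix.linftyOpNormedAlgebra in
theorem hasDerivAt_const_matrix (A : Matrix (Fin n) (Fin n) ℝ) (t : ℝ) :
    HasDerivAt (fun _ : ℝ => A) 0 t :=
  hasDerivAt_const t A

/-- For `A ∈ 𝔪` the curve `g exp(tA)·o` is a geodesic. -/
theorem exists_isGeodesicFrom (hk : k ≤ n) (g : Matrix.orthogonalGroup (Fin n) ℝ)
    {A : Matrix (Fin n) (Fin n) ℝ} (hA : A ∈ mSpace k n) :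
    ∃ γ : ℝ → Gr k n, IsGeodesicFrom g A γ := by
  let h : ℝ → Matrix.orthogonalGroup (Fin n) ℝ := fun t =>
    g * ⟨NormedSpace.exp (t • A), exp_smul_mem_orthogonalGroup hA.1 t⟩
  refine ⟨fun t => graphPlane (orthFrame hk (h t)) 0, h, fun _ => A,
    ⟨fun t => graphPlane_orthFrame_zero hk _, fun _ => hA, fun t => ?_⟩,
    hasDerivAt_const_matrix A, ?_, rfl⟩
  · exact hasDerivAt_mul_exp_smul (g : Matrix (Fin n) (Fin n) ℝ) A t
  · apply Subtype.ext
    simp [h]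

/-- `X' = 0` makes `X` constantly `A`, so the lift solves `h' = hA`. This equation is used directly,
with no appeal to uniqueness of its solution. -/
theorem IsGeodesicFrom.exists_lift {g : Matrix.orthogonalGroup (Fin n) ℝ}
    {A : Matrix (Fin n) (Fin n) ℝ} {γ : ℝ → Gr k n} (hγ : IsGeodesicFrom g A γ) :
    ∃ h : ℝ → Matrix.orthogonalGroup (Fin n) ℝ, h 0 = g ∧ A ∈ mSpace k n ∧
      (∀ t, (γ t).1 = orbit k (h t)) ∧
      ∀ t, HasDerivAt (fun s => (h s : Matrix (Fin n) (Fin n) ℝ))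
        ((h t : Matrix (Fin n) (Fin n) ℝ) * A) t := by
  obtain ⟨h, X, hX, hX', rfl, rfl⟩ := hγ
  refine ⟨h, rfl, hX.mem 0, hX.lifts, fun t => ?_⟩
  rw [← eq_of_hasDerivAt_zero hX' t 0]
  exact hX.deriv t

theorem mem_mSpaceOf_iff (g : Matrix.orthogonalGroup (Fin n) ℝ) (A : Matrix (Fin n) (Fin n) ℝ) :
    A ∈ mSpaceOf k W g ↔ A ∈ mSpace k n ∧
      ∀ w ∈ W, act A (act (g⁻¹ : Matrix.orthogonalGroup (Fin n) ℝ) w) = 0 := by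
  refine and_congr_right' (forall₂_congr fun w _ => ?_)
  rw [← (WithLp.toLp_injective 2).eq_iff]
  rfl

theorem orbit_le_orthogonal_iff (g : Matrix.orthogonalGroup (Fin n) ℝ) :
    orbit k g ≤ Wᗮ ↔
      ∀ w ∈ W, act (g⁻¹ : Matrix.orthogonalGroup (Fin n) ℝ) w ∈ (origin k n)ᗮ := by
  constructor
  · intro h w hw
    refine (Submodule.mem_orthogonal _ _).2 fun x hx => ?_
    rw [← inner_act_orthogonal]
    exact (Submodule.mem_orthogonal' _ _).1 (h (act_mem_orbit g hx)) w hw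
  · intro h z hz
    refine (Submodule.mem_orthogonal' _ _).2 fun w hw => ?_
    rw [← act_act_inv g z, inner_act_orthogonal]
    exact (Submodule.mem_orthogonal _ _).1 (h w hw) _ ((mem_orbit_iff g z).1 hz)

/-- A geodesic with the initial data `(g, A)`, `A ∈ 𝔪'`, consists of planes orthogonal to `W`. -/
theorem IsGeodesicFrom.mem_planesOrthogonalTo {g : Matrix.orthogonalGroup (Fin n) ℝ}
    {A : Matrix (Fin n) (Fin n) ℝ} {γ : ℝ → Gr k n} (hγ : IsGeodesicFrom g A γ)
    (hA : A ∈ mSpaceOf k W g) (h₀ : γ 0 ∈ planesOrthogonalTo k W) (t : ℝ) :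
    γ t ∈ planesOrthogonalTo k W := by
  obtain ⟨h, rfl, -, hlift, hderiv⟩ := hγ.exists_lift
  rw [mem_planesOrthogonalTo_iff, hlift, orbit_le_orthogonal_iff] at h₀ ⊢
  intro w hw
  have h1 := h₀ w hw
  set u := act ((h 0)⁻¹ : Matrix.orthogonalGroup (Fin n) ℝ) w with hu
  -- `(hu)' = hAu = 0`, so `h(t)` keeps sending `u` to `w`.
  have h2 : ∀ t, HasDerivAt (fun s => act (h s) u) 0 t := fun t => by
    have := (hasDerivAt_act (hderiv t)).clm_apply (hasDerivAt_const t u)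
    rw [act_mul, ((mem_mSpaceOf_iff _ _).1 hA).2 w hw] at this
    simpa using this
  have h3 : act (h t) u = w := by
    rw [is_const_of_deriv_eq_zero (fun s => (h2 s).differentiableAt) (fun s => (h2 s).deriv) t 0,
      hu, act_act_inv]
  rw [← h3, act_inv_act]
  exact h1

/-! ### The Lie triple system and tangency to `N`. -/

theorem S_mul_lie_mul_S (x y : Matrix (Fin n) (Fin n) ℝ) :
    S k n * ⁅x, y⁆ * S k n = ⁅S k n * x * S k n, S k n * y * S k n⁆ := by
  have h : ∀ x y, S k n * (x * y) * S k n = S k n * x * S k n * (S k n * y * S k n) := by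
    intro x y
    simp only [mul_assoc]
    rw [← mul_assoc (S k n) (S k n), S_mul_S, one_mul]
  rw [Ring.lie_def, Ring.lie_def, mul_sub, sub_mul, h, h]

/-- Conjugation by `S` respects brackets and changes three signs, so a triple bracket stays in `𝔪`.
Every monomial of its expansion applies one of `a`, `b`, `c` first to `g⁻¹w`, giving zero. -/
theorem isLieTripleSystem_mSpaceOf (g : Matrix.orthogonalGroup (Fin n) ℝ) :
    IsLieTripleSystem (mSpaceOf k W g) := by
  intro a ha b hb c hc
  rw [mem_mSpaceOf_iff] at *
  refine ⟨⟨?_, ?_⟩, fun w hw => ?_⟩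
  · exact LieSubalgebra.lie_mem _ (LieSubalgebra.lie_mem _ ha.1.1 hb.1.1) hc.1.1
  · rw [S_mul_lie_mul_S, S_mul_lie_mul_S, ha.1.2, hb.1.2, hc.1.2]
    simp
  · have hsub : ∀ (M N : Matrix (Fin n) (Fin n) ℝ) x, act (M - N) x = act M x - act N x := by
      intro M N x
      simp [act]
    simp only [Ring.lie_def, hsub, act_mul, ha.2 w hw, hb.2 w hw, hc.2 w hw, map_zero, sub_zero]

/-- The initial velocity of the geodesic with the initial data `(g, A)` is tangent to the set of
the planes orthogonal to `W` if and only if `A ∈ 𝔪'`. -/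
theorem IsGeodesicFrom.velocity_mem_iff (Φ : (E m × W) ≃L[ℝ] E n)
    (hΦ : ∀ z, z ∈ Wᗮ ↔ (Φ.symm z).2 = 0) {g : Matrix.orthogonalGroup (Fin n) ℝ}
    {A : Matrix (Fin n) (Fin n) ℝ} {γ : ℝ → Gr k n} (hγ : IsGeodesicFrom g A γ)
    (h₀ : γ 0 ∈ planesOrthogonalTo k W) :
    velocity γ 0 ∈ tangentBundleOf (Model k m) (pushPlane k Φ) ↔ A ∈ mSpaceOf k W g := by
  obtain ⟨h, rfl, hA, hlift, hderiv⟩ := hγ.exists_lift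
  have h₀' := h₀
  rw [← range_pushPlane Φ hΦ] at h₀'
  obtain ⟨Q, hQ⟩ := h₀'
  obtain ⟨e⟩ := exists_model_splitting Φ Q
  obtain ⟨F, X₀, rfl⟩ := exists_graphPlane Q
  rw [pushPlane_graphPlane Φ e] at hQ
  set B := extendFrame Φ e F with hB
  obtain ⟨X, X', hX0, hX', hev, hrel⟩ :=
    exists_hasDerivAt_graphPlane hlift (hderiv 0) B hQ.symm
  rw [velocity_eq_graphVelocity B hX' hev, hX0, graphVelocity_mem_tangentBundleOf_iff]
  constructor
  · rintro ⟨Y, rfl⟩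
    refine (mem_mSpaceOf_iff _ _).2 ⟨hA, fun w hw => ?_⟩
    set u := act ((h 0)⁻¹ : Matrix.orthogonalGroup (Fin n) ℝ) w
    have hu : u ∈ (origin k n)ᗮ := by
      rw [mem_planesOrthogonalTo_iff, hlift, orbit_le_orthogonal_iff] at h₀
      exact h₀ w hw
    have hAu : act A u ∈ origin k n := act_mem_origin hA hu
    -- Neither the position nor the velocity has a `W`-coordinate, so the right side of `hrel` has
    -- none; hence neither has `h(0)Ax`.
    have hW : ∀ x ∈ origin k n, act (h 0) (act A x) ∈ Wᗮ := by
      intro x hx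
      have h1 := hrel x hx
      rw [act_mul, hB, extendFrame_symm_apply] at h1
      simp only [modelSplit_apply] at h1
      rw [← map_add, e.symm.injective.eq_iff] at h1
      rw [hΦ]
      simpa using congrArg Prod.snd h1
    -- Taking `x = Au` turns orthogonality to `w` into `⟪Au, Au⟫ = 0`, by skewness of `A`.
    have h1 := (Submodule.mem_orthogonal' _ _).1 (hW _ hAu) w hw
    rw [inner_act_orthogonal, inner_act_left, (LieAlgebra.Orthogonal.mem_so _ _ _).1 hA.1, act_neg,
      inner_neg_right, neg_eq_zero] at h1
    exact inner_self_eq_zero.1 h1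
  · intro hA'
    -- The geodesic stays in `N`, so the `W`-part of its coordinate vanishes near `0`, and so does
    -- the derivative of that part.
    have hmem := hγ.mem_planesOrthogonalTo hA' h₀
    have h1 : ∀ᶠ t in nhds (0 : ℝ), ((modelSplit e).symm (X t)).2 = 0 := by
      filter_upwards [hev] with t ht
      have h2 := hmem t
      rw [ht] at h2
      exact modelSplit_snd_eq_zero Φ hΦ e F _ h2
    let r : Model k n →L[ℝ] (E k →L[ℝ] W) :=
      (ContinuousLinearMap.snd ℝ (Model k m) (E k →L[ℝ] W)).comp
        ((modelSplit e).symm : Model k n →L[ℝ] _)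
    have h1' : r ∘ X =ᶠ[nhds 0] fun _ => 0 := h1
    have h3 : r X' = 0 := (r.hasFDerivAt.comp_hasDerivAt (0 : ℝ) hX').unique
      ((hasDerivAt_const (0 : ℝ) (0 : E k →L[ℝ] W)).congr_of_eventuallyEq h1')
    have h4 : ((modelSplit e).symm X').2 = 0 := h3
    refine ⟨((modelSplit e).symm X').1, ?_⟩
    rw [← h4]
    simp

/-- Each tangent vector of `G(k,n)` is the initial velocity of a geodesic. -/
theorem exists_isGeodesic_velocity_eq (v : TGr k n) :
    ∃ γ : ℝ → Gr k n, IsGeodesic γ ∧ velocity γ 0 = v := by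
  have hk : k ≤ n := le_of_gr v.1
  obtain ⟨g, hg⟩ := exists_orbit_eq v.1
  have hv : v.1 = graphPlane (orthFrame hk g) 0 :=
    Subtype.ext (hg.trans (graphPlane_orthFrame_zero hk g).symm)
  obtain ⟨Y, hY⟩ := exists_graphVelocity_eq _ _ v hv
  obtain ⟨A, hA, hAY⟩ := exists_mem_mSpace hk Y
  obtain ⟨γ, hγ⟩ := exists_isGeodesicFrom hk g hA
  refine ⟨γ, ⟨g, A, hγ⟩, ?_⟩
  obtain ⟨h, rfl, -, hlift, hderiv⟩ := hγ.exists_lift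
  have h₀ : γ 0 = graphPlane (orthFrame hk (h 0)) 0 :=
    Subtype.ext ((hlift 0).trans (graphPlane_orthFrame_zero hk (h 0)).symm)
  obtain ⟨X, X', hX0, hX', hev, hrel⟩ := exists_hasDerivAt_graphPlane hlift (hderiv 0) _ h₀
  rw [velocity_eq_graphVelocity _ hX' hev, hX0, ← hY]
  congr 1
  ext1 x
  have hsymm : ∀ z, (orthFrame hk (h 0)).symm (act (h 0) (stdFrame hk z)) = z := fun z =>
    (orthFrame hk (h 0)).symm_apply_apply z
  -- In the frame moved by `g`, the base coordinate is `0` and `A` sends `(x, 0)` to `(0, Yx)`, so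
  -- the relation reads `Yx = X'x`.
  have h1 := hrel _ (stdFrame_mem_origin hk x)
  rw [act_mul, hAY, hsymm, hsymm] at h1
  simpa using h1.symm

theorem isTotallyGeodesicEmbedding_pushPlane (Φ : (E m × W) ≃L[ℝ] E n)
    (hΦ : ∀ z, z ∈ Wᗮ ↔ (Φ.symm z).2 = 0) :
    IsTotallyGeodesicEmbedding (Model k m) (pushPlane k Φ) where
  embedding := ⟨isImmersion_pushPlane k Φ, isEmbedding_pushPlane Φ hΦ⟩
  exists_geodesic v _ := exists_isGeodesic_velocity_eq v
  geodesic_mem := by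
    rintro γ ⟨g, A, hγ⟩ hv
    have h₀ : γ 0 ∈ planesOrthogonalTo k W := by
      rw [← range_pushPlane Φ hΦ]
      obtain ⟨u, hu⟩ := hv
      exact ⟨u.1, congrArg Bundle.TotalSpace.proj hu⟩
    -- Any radius works, since the geodesic remains in `N` for all times.
    refine ⟨1, one_pos, fun t _ => ?_⟩
    rw [range_pushPlane Φ hΦ]
    exact hγ.mem_planesOrthogonalTo ((hγ.velocity_mem_iff Φ hΦ h₀).1 hv) h₀ t

end Grass

end

theorem mainTheorem7 (k m n : ℕ) (hmn : m ≤ n) (W : Submodule ℝ (Grass.E n))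
    (hW : Module.finrank ℝ W = n - m) :
    ∃ f : Grass.Gr k m → Grass.Gr k n,
      Set.range f = Grass.planesOrthogonalTo k W ∧
      Grass.IsTotallyGeodesicEmbedding (Grass.Model k m) f ∧
      ∀ P ∈ Grass.planesOrthogonalTo k W, ∀ g : Matrix.orthogonalGroup (Fin n) ℝ,
        P.1 = Grass.orbit k g →
          Grass.IsLieTripleSystem (Grass.mSpaceOf k W g) ∧
          ∀ A ∈ Grass.mSpace k n, A ∈ Grass.mSpaceOf k W g ↔
            ∃ γ : ℝ → Grass.Gr k n, Grass.IsGeodesicFrom g A γ ∧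
              Grass.velocity γ 0 ∈ Grass.tangentBundleOf (Grass.Model k m) f := by
  obtain ⟨Φ, hΦ⟩ := Grass.exists_splitting hmn W hW
  refine ⟨Grass.pushPlane k Φ, Grass.range_pushPlane Φ hΦ,
    Grass.isTotallyGeodesicEmbedding_pushPlane Φ hΦ, fun P hP g hg =>
    ⟨Grass.isLieTripleSystem_mSpaceOf g, fun A hA => ?_⟩⟩
  have hk : k ≤ n := Grass.le_of_gr P
  have h₀ : ∀ γ : ℝ → Grass.Gr k n, Grass.IsGeodesicFrom g A γ →
      γ 0 ∈ Grass.planesOrthogonalTo k W := by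
    intro γ hγ
    obtain ⟨h, rfl, -, hlift, -⟩ := hγ.exists_lift
    rwa [show γ 0 = P from Subtype.ext ((hlift 0).trans hg.symm)]
  constructor
  · intro hA'
    obtain ⟨γ, hγ⟩ := Grass.exists_isGeodesicFrom hk g hA
    exact ⟨γ, hγ, (hγ.velocity_mem_iff Φ hΦ (h₀ γ hγ)).2 hA'⟩
  · rintro ⟨γ, hγ, hv⟩
    exact (hγ.velocity_mem_iff Φ hΦ (h₀ γ hγ)).1 hv
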